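/- **Quantum graphs.** A quantum graph $\Gamma$ is a finite graph $(V,E)$ without loops, with a length $l_e>0$ and an identification $e\cong[0,l_e]$ for every edge $e$, together with, at every vertex $v$ with set of incident edges $E_v$, homogeneous boundary conditions $A_v f|_v+B_v f'|_v=0$. Here $f=(f|_e)_{e\in E}$, $f|_e:[0,l_e]\to\mathbb C$; $f|_v$ and $f'|_v$ are the vectors of the values and of the outgoing derivatives of $f$ at $v$ along the edges in $E_v$; and $A_v,B_v$ are complex matrices with columns indexed by $E_v$ (and with any finite number of rows; square matrices are a special case). For $\lambda\in\mathbb C$ let $\Phi_\Gamma(\lambda)$ be the space of all $f$ with $f|_e\in W^{2,2}([0,l_e])$ for every $e$ that satisfy the boundary conditions at all vertices and $-f''=\lambda f$ on every edge. **Setting.** Let $G$ be a finite group acting on $\Gamma$, i.e. acting on $V$ and $E$ such that lengths, incidence and boundary conditions are preserved, and suppose that no element of $G$ carries a vertex to one of its neighbours (this can always be achieved by adding vertices of valency two with Neumann conditions). Let $R=(W,\rho)$ be a complex representation of $G$ of finite dimension $d$. **The quotient graphs $\Gamma/R$.** Choose representatives $\tilde e^i$ of the orbits $E/G$, representatives $\tilde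 v_k$ of $V/G$, a basis $B$ of $W$ and, for each $i$, a basis $B^i=(b^i_1,\dots,b^i_d)$ of $W$ such that, for the restriction of $R$ to the stabilizer $G_{\tilde e^i}$, the vectors $b^i_1,\dots,b^i_{d_i}$ form a basis of the trivial component (of dimension $d_i$) and the vectors $b^i_j$ with $j>d_i$ lie in the sum of the isotypic components of the nontrivial irreducible representations. For each $k$ write $E_{\tilde v_k}=\{g_l\tilde e^{\nu_l}\}_{l=1}^n$ with $g_l\in G$. The quotient has vertices $v_k$ and edges $e^i_j$ ($1\le j\le d_i$); $e^i_j$ is a copy of $\tilde e^i$ (with its length and coordinate), and connects the vertices corresponding to the orbits of the two ends of $\tilde e^i$. Its boundary conditions at $v_k$ are given by $$A_{v_k}=(A_{\tilde v_k}\otimes I_d)\,D\,\Theta,\qquad B_{v_k}=(B_{\tilde v_k}\otimes I_d)\,D\,\Theta,$$ $$D=\operatorname{diag}\bigl([\rho(g_1^{-1})]^{B}_{B^{\nu_1}},\dots,[\rho(g_n^{-1})]^{B}_{B^{\nu_n}}\bigr)^{T},$$ where $[T]^{B}_{B'}$ is the matrix of $T$ from the basis $B$ to the basis $B'$, i.e.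 $T b_c=\sum_r ([T]^{B}_{B'})_{rc}\,b'_r$, and $\Theta$ is the matrix with rows $(l,r)$ ($1\le l\le n$, $1\le r\le d$) and columns the edges $e^i_j$ at $v_k$, whose entry is $1$ if $\nu_l=i$ and $r=j$, and $0$ otherwise. The pair $(A_{v_k},B_{v_k})$ may be replaced by any pair of matrices describing the same boundary conditions (e.g. by eliminating redundant rows). **Statement.** Any two quotient graphs $\Gamma_1,\Gamma_2$ obtained from the same $\Gamma$, $G$ and $R$ by this construction, for any two systems of choices, are *transplantable*: for suitable directions of the coordinates along the edges of $\Gamma_1$ and $\Gamma_2$ there is a complex matrix $T=(T_{e_2e_1})$, indexed by the edges $e_2$ of $\Gamma_2$ and $e_1$ of $\Gamma_1$ and independent of $\lambda$, with $T_{e_2e_1}=0$ unless $l_{e_1}=l_{e_2}$, such that for every $\lambda\in\mathbb C$ the linear map $f\mapsto\varphi$, $$\varphi|_{e_2}=\sum_{e_1}T_{e_2e_1}\,f|_{e_1},$$ is a bijection of $\Phi_{\Gamma_1}(\lambda)$ onto $\Phi_{\Gamma_2}(\lambda)$. -/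

import Mathlib

open MeasureTheory
open scoped Kronecker

universe u

noncomputable section

/-- A finite metric graph. The edge `e` is identified with `[0, len e]`, where the coordinate `0`
is at the vertex `src e` and the coordinate `len e` is at the vertex `tgt e`; this is only a
choice of coordinate, the edge itself is undirected. There are no loops; parallel edges are
allowed. -/
structure MetricGraph where
  V : Type u
  E : Type u
  [fintypeV : Fintype V]
  [fintypeE : Fintype E]
  src : E → V
  tgt : E → V
  src_ne_tgt : ∀ e, src e ≠ tgt e
  len : E → ℝ
  len_pos : ∀ e, 0 < len e

attribute [instance] MetricGraph.fintypeV MetricGraph.fintypeE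

namespace MetricGraph

variable (M : MetricGraph.{u})

/-- The set `E_v` of edges incident to the vertex `v`. -/
def IncEdge (v : M.V) : Type u := {e : M.E // M.src e = v ∨ M.tgt e = v}

instance (v : M.V) : Fintype (M.IncEdge v) := by
  classical exact inferInstanceAs (Fintype {e : M.E // M.src e = v ∨ M.tgt e = v})

/-- A function on the graph: a family of functions `[0, len e] → ℂ`, one for each edge. -/
abbrev Fun : Type u := ∀ e : M.E, Set.Icc (0 : ℝ) (M.len e) → ℂ

end MetricGraph

/-- Extension by zero of a function on `[0, l]` to the real line. -/
def extZero {l : ℝ} (f : Set.Icc (0 : ℝ) l → ℂ) : ℝ → ℂ := by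
  classical exact fun x => if h : x ∈ Set.Icc (0 : ℝ) l then f ⟨x, h⟩ else 0

/-- The derivative of a function on `[0, l]` (one-sided at the two ends). -/
def edgeDeriv {l : ℝ} (f : Set.Icc (0 : ℝ) l → ℂ) (x : ℝ) : ℂ :=
  derivWithin (extZero f) (Set.Icc 0 l) x

/-- `f` belongs to `W^{2,2}([0, l])` with second derivative `w ∈ L²`: `f` is differentiable
and `f'` is absolutely continuous with derivative `w`. -/
structure HasL2SecondDeriv {l : ℝ} (f : Set.Icc (0 : ℝ) l → ℂ) (w : ℝ → ℂ) : Prop where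
  diff : DifferentiableOn ℝ (extZero f) (Set.Icc 0 l)
  memLp : MemLp w 2 (volume.restrict (Set.Icc 0 l))
  deriv_eq : ∀ x ∈ Set.Icc (0 : ℝ) l, edgeDeriv f x = edgeDeriv f 0 + ∫ t in (0 : ℝ)..x, w t

namespace MetricGraph

variable (M : MetricGraph.{u})

/-- The vector of the values at `v` of `f` along the edges incident to `v`. -/
def vertexValue (f : M.Fun) (v : M.V) (e : M.IncEdge v) : ℂ := by
  classical exact
    if M.src e.1 = v then extZero (f e.1) 0 else extZero (f e.1) (M.len e.1)

/-- The vector of the outgoing derivatives at `v` of `f` along the edges incident to `v`. -/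
def vertexDeriv (f : M.Fun) (v : M.V) (e : M.IncEdge v) : ℂ := by
  classical exact
    if M.src e.1 = v then edgeDeriv (f e.1) 0 else -edgeDeriv (f e.1) (M.len e.1)

end MetricGraph

/-- Homogeneous boundary conditions `A_v · f|_v + B_v · f'|_v = 0` at every vertex `v`. The
columns of `A_v` and `B_v` are indexed by the edges at `v`, the rows by any finite set; square
matrices are the case `Row v = E_v`. -/
structure BoundaryConditions (M : MetricGraph.{u}) where
  Row : M.V → Type u
  [fintypeRow : ∀ v, Fintype (Row v)]
  A : ∀ v, Matrix (Row v) (M.IncEdge v) ℂ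
  B : ∀ v, Matrix (Row v) (M.IncEdge v) ℂ

attribute [instance] BoundaryConditions.fintypeRow

namespace BoundaryConditions

variable {M : MetricGraph.{u}}

/-- The condition at `v`, on a vector `x` of values and a vector `y` of outgoing derivatives. -/
def Holds (bc : BoundaryConditions M) (v : M.V) (x y : M.IncEdge v → ℂ) : Prop :=
  (bc.A v).mulVec x + (bc.B v).mulVec y = 0

/-- Two systems of matrices describe the same boundary conditions. -/
def Same (bc bc' : BoundaryConditions M) : Prop :=
  ∀ (v : M.V) (x y : M.IncEdge v → ℂ), bc.Holds v x y ↔ bc'.Holds v x y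

end BoundaryConditions

/-- A quantum graph: a metric graph with boundary conditions at the vertices (the operator is the
negative Laplacian `f ↦ -f''` on every edge). -/
structure QuantumGraph where
  graph : MetricGraph.{u}
  bc : BoundaryConditions graph

section lemmas

variable {l : ℝ}

lemma extZero_add (f g : Set.Icc (0 : ℝ) l → ℂ) : extZero (f + g) = extZero f + extZero g := by
  funext x
  simp only [extZero, Pi.add_apply]
  split_ifs <;> simp

lemma extZero_smul (c : ℂ) (f : Set.Icc (0 : ℝ) l → ℂ) : extZero (c • f) = c • extZero f := by
  funext x
  simp only [extZero, Pi.smul_apply]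
  split_ifs <;> simp

lemma extZero_zero : extZero (0 : Set.Icc (0 : ℝ) l → ℂ) = 0 := by
  funext x
  simp [extZero]

lemma edgeDeriv_add {f g : Set.Icc (0 : ℝ) l → ℂ}
    (hf : DifferentiableOn ℝ (extZero f) (Set.Icc 0 l))
    (hg : DifferentiableOn ℝ (extZero g) (Set.Icc 0 l)) {x : ℝ} (hx : x ∈ Set.Icc (0 : ℝ) l) :
    edgeDeriv (f + g) x = edgeDeriv f x + edgeDeriv g x := by
  rw [edgeDeriv, extZero_add, derivWithin_add (hf x hx) (hg x hx)]; rfl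

lemma edgeDeriv_smul (c : ℂ) {f : Set.Icc (0 : ℝ) l → ℂ}
    (hf : DifferentiableOn ℝ (extZero f) (Set.Icc 0 l)) {x : ℝ} (hx : x ∈ Set.Icc (0 : ℝ) l) :
    edgeDeriv (c • f) x = c * edgeDeriv f x := by
  rw [edgeDeriv, extZero_smul, derivWithin_const_smul c (hf x hx)]; rfl

lemma edgeDeriv_zero (x : ℝ) : edgeDeriv (0 : Set.Icc (0 : ℝ) l → ℂ) x = 0 := by
  rw [edgeDeriv, extZero_zero]
  simp

lemma HasL2SecondDeriv.intervalIntegrable {f : Set.Icc (0 : ℝ) l → ℂ} {w : ℝ → ℂ}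
    (h : HasL2SecondDeriv f w) {x : ℝ} (hx : x ∈ Set.Icc (0 : ℝ) l) :
    IntervalIntegrable w volume 0 x := by
  have h1 : IntegrableOn w (Set.Icc 0 l) volume := h.memLp.integrable (by norm_num)
  rw [intervalIntegrable_iff_integrableOn_Icc_of_le hx.1]
  exact h1.mono_set (Set.Icc_subset_Icc_right hx.2)

lemma HasL2SecondDeriv.add {f g : Set.Icc (0 : ℝ) l → ℂ} {w z : ℝ → ℂ} (hl : 0 ≤ l)
    (hf : HasL2SecondDeriv f w) (hg : HasL2SecondDeriv g z) :
    HasL2SecondDeriv (f + g) (w + z) where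
  diff := by rw [extZero_add]; exact hf.diff.add hg.diff
  memLp := hf.memLp.add hg.memLp
  deriv_eq x hx := by
    rw [edgeDeriv_add hf.diff hg.diff hx, edgeDeriv_add hf.diff hg.diff ⟨le_rfl, hl⟩,
      hf.deriv_eq x hx, hg.deriv_eq x hx]
    simp only [Pi.add_apply]
    rw [intervalIntegral.integral_add (hf.intervalIntegrable hx) (hg.intervalIntegrable hx)]
    ring

lemma HasL2SecondDeriv.smul {f : Set.Icc (0 : ℝ) l → ℂ} {w : ℝ → ℂ} (hl : 0 ≤ l) (c : ℂ)
    (hf : HasL2SecondDeriv f w) : HasL2SecondDeriv (c • f) (c • w) where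
  diff := by rw [extZero_smul]; exact hf.diff.const_smul c
  memLp := hf.memLp.const_smul c
  deriv_eq x hx := by
    rw [edgeDeriv_smul c hf.diff hx, edgeDeriv_smul c hf.diff ⟨le_rfl, hl⟩, hf.deriv_eq x hx]
    simp only [Pi.smul_apply, smul_eq_mul, intervalIntegral.integral_const_mul]
    ring

lemma HasL2SecondDeriv.zero : HasL2SecondDeriv (0 : Set.Icc (0 : ℝ) l → ℂ) 0 where
  diff := by rw [extZero_zero]; exact differentiableOn_const 0
  memLp := MemLp.zero
  deriv_eq x hx := by simp [edgeDeriv_zero]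

end lemmas

namespace MetricGraph

variable (M : MetricGraph.{u})

/-- `W^{2,2}` functions on the graph, without boundary conditions, with `-f'' = lam f` almost
everywhere on every edge. -/
def IsEdgewiseEigen (lam : ℂ) (f : M.Fun) : Prop :=
  ∀ e, ∃ w : ℝ → ℂ, HasL2SecondDeriv (f e) w ∧
    ∀ᵐ x ∂(volume.restrict (Set.Icc 0 (M.len e))), -w x = lam * extZero (f e) x

variable {M}

lemma zero_mem_Icc (e : M.E) : (0 : ℝ) ∈ Set.Icc 0 (M.len e) := ⟨le_rfl, (M.len_pos e).le⟩

lemma len_mem_Icc (e : M.E) : M.len e ∈ Set.Icc 0 (M.len e) := ⟨(M.len_pos e).le, le_rfl⟩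

lemma IsEdgewiseEigen.diff {lam : ℂ} {f : M.Fun} (hf : M.IsEdgewiseEigen lam f) (e : M.E) :
    DifferentiableOn ℝ (extZero (f e)) (Set.Icc 0 (M.len e)) := (hf e).choose_spec.1.diff

lemma vertexValue_add (f g : M.Fun) (v : M.V) :
    M.vertexValue (f + g) v = M.vertexValue f v + M.vertexValue g v := by
  funext e
  simp only [vertexValue, Pi.add_apply, extZero_add]
  split_ifs <;> rfl

lemma vertexValue_smul (c : ℂ) (f : M.Fun) (v : M.V) :
    M.vertexValue (c • f) v = c • M.vertexValue f v := by
  funext e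
  simp only [vertexValue, Pi.smul_apply, extZero_smul]
  split_ifs <;> rfl

lemma vertexDeriv_add {lam : ℂ} {f g : M.Fun} (hf : M.IsEdgewiseEigen lam f)
    (hg : M.IsEdgewiseEigen lam g) (v : M.V) :
    M.vertexDeriv (f + g) v = M.vertexDeriv f v + M.vertexDeriv g v := by
  funext e
  simp only [vertexDeriv, Pi.add_apply, edgeDeriv_add (hf.diff e.1) (hg.diff e.1)
    (zero_mem_Icc e.1), edgeDeriv_add (hf.diff e.1) (hg.diff e.1) (len_mem_Icc e.1)]
  split_ifs <;> ring

lemma vertexDeriv_smul {lam : ℂ} (c : ℂ) {f : M.Fun} (hf : M.IsEdgewiseEigen lam f) (v : M.V) :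
    M.vertexDeriv (c • f) v = c • M.vertexDeriv f v := by
  funext e
  simp only [vertexDeriv, Pi.smul_apply, edgeDeriv_smul c (hf.diff e.1) (zero_mem_Icc e.1),
    edgeDeriv_smul c (hf.diff e.1) (len_mem_Icc e.1)]
  split_ifs <;> simp

end MetricGraph

/-- The eigenspace `Φ_Γ(lam)`: the `W^{2,2}` functions on `Γ` that satisfy the boundary conditions
at all vertices and `-f'' = lam f`. -/
def QuantumGraph.eigenspace (Γ : QuantumGraph.{u}) (lam : ℂ) : Submodule ℂ Γ.graph.Fun where
  carrier := {f | Γ.graph.IsEdgewiseEigen lam f ∧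
    ∀ v, Γ.bc.Holds v (Γ.graph.vertexValue f v) (Γ.graph.vertexDeriv f v)}
  add_mem' := by
    rintro f g ⟨hf, hf'⟩ ⟨hg, hg'⟩
    refine ⟨fun e => ?_, fun v => ?_⟩
    · obtain ⟨w, hw, hw'⟩ := hf e
      obtain ⟨z, hz, hz'⟩ := hg e
      refine ⟨w + z, hw.add (Γ.graph.len_pos e).le hz, ?_⟩
      filter_upwards [hw', hz'] with x h1 h2
      simp only [Pi.add_apply, extZero_add, mul_add, ← h1, ← h2, neg_add]
    · have h1 := hf' v
      have h2 := hg' v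
      unfold BoundaryConditions.Holds at h1 h2 ⊢
      rw [MetricGraph.vertexValue_add, MetricGraph.vertexDeriv_add hf hg, Matrix.mulVec_add,
        Matrix.mulVec_add, add_add_add_comm, h1, h2, add_zero]
  zero_mem' := by
    refine ⟨fun e => ⟨0, HasL2SecondDeriv.zero, ?_⟩, fun v => ?_⟩
    · simp only [Pi.zero_apply, extZero_zero]
      simp
    · have h1 : Γ.graph.vertexValue 0 v = 0 := by
        funext e
        simp only [MetricGraph.vertexValue, Pi.zero_apply, extZero_zero]
        simp
      have h2 : Γ.graph.vertexDeriv 0 v = 0 := by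
        funext e
        simp only [MetricGraph.vertexDeriv, Pi.zero_apply, edgeDeriv_zero]
        simp
      simp [BoundaryConditions.Holds, h1, h2]
  smul_mem' := by
    rintro c f ⟨hf, hf'⟩
    refine ⟨fun e => ?_, fun v => ?_⟩
    · obtain ⟨w, hw, hw'⟩ := hf e
      refine ⟨c • w, hw.smul (Γ.graph.len_pos e).le c, ?_⟩
      filter_upwards [hw'] with x h1
      simp only [Pi.smul_apply, extZero_smul, smul_eq_mul]
      rw [← mul_neg, h1]
      ring
    · have h1 := hf' v
      unfold BoundaryConditions.Holds at h1 ⊢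
      rw [MetricGraph.vertexValue_smul, MetricGraph.vertexDeriv_smul c hf, Matrix.mulVec_smul,
        Matrix.mulVec_smul, ← smul_add, h1, smul_zero]

/-! ### Transplantations -/

/-- The edge-wise linear map with coefficient matrix `T`: the restriction to the edge `e₂` of the
image of `f` is `∑ T e₂ e₁ • f|_{e₁}`, where the coordinate of an edge is reversed
(`x ↦ len - x`) if the edge is marked by `r₁` or `r₂`. -/
def transplantMap (M₁ M₂ : MetricGraph.{u}) (T : Matrix M₂.E M₁.E ℂ) (r₁ : M₁.E → Bool)
    (r₂ : M₂.E → Bool) : M₁.Fun →ₗ[ℂ] M₂.Fun where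
  toFun f e₂ x := ∑ e₁, T e₂ e₁ *
    extZero (f e₁) (if r₁ e₁ = r₂ e₂ then (x : ℝ) else M₂.len e₂ - x)
  map_add' f g := by
    funext e₂ x
    simp only [Pi.add_apply, extZero_add, mul_add, Finset.sum_add_distrib]
  map_smul' c f := by
    funext e₂ x
    simp only [Pi.smul_apply, extZero_smul, smul_eq_mul, Finset.mul_sum, RingHom.id_apply]
    exact Finset.sum_congr rfl fun e₁ _ => by ring

/-- `Γ₁` and `Γ₂` are transplantable: for some choice of the direction of the coordinate on every
edge there is one linear map, expressing the restriction to each edge of `Γ₂` as a linear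
combination with constant coefficients of the restrictions to edges of `Γ₁` of the same length,
which bijects each eigenspace of `Γ₁` onto the corresponding eigenspace of `Γ₂`. -/
def Transplantable (Γ₁ Γ₂ : QuantumGraph.{u}) : Prop :=
  ∃ (T : Matrix Γ₂.graph.E Γ₁.graph.E ℂ) (r₁ : Γ₁.graph.E → Bool) (r₂ : Γ₂.graph.E → Bool),
    (∀ e₂ e₁, T e₂ e₁ ≠ 0 → Γ₁.graph.len e₁ = Γ₂.graph.len e₂) ∧
    ∀ lam : ℂ, Set.BijOn (transplantMap Γ₁.graph Γ₂.graph T r₁ r₂)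
      (Γ₁.eigenspace lam) (Γ₂.eigenspace lam)

/-! ### Group actions -/

section action

variable (G : Type*) [Group G]

/-- The action of `G` on vertices and edges preserves lengths and incidence. -/
structure MetricGraph.IsAction (M : MetricGraph.{u}) [MulAction G M.V] [MulAction G M.E] :
    Prop where
  len_smul : ∀ (g : G) (e : M.E), M.len (g • e) = M.len e
  inc_smul : ∀ (g : G) (e : M.E) (v : M.V), M.src e = v ∨ M.tgt e = v →
    M.src (g • e) = g • v ∨ M.tgt (g • e) = g • v

/-- No vertex is carried by `G` to one of its neighbors. -/
def MetricGraph.NoNeighborInOrbit (M : MetricGraph.{u}) [MulAction G M.V] : Prop :=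
  ∀ (g : G) (e : M.E), g • M.src e ≠ M.tgt e

variable {G}

/-- `g` maps the edges at `v` to the edges at `g • v`. -/
def MetricGraph.IsAction.smulInc {M : MetricGraph.{u}} [MulAction G M.V] [MulAction G M.E]
    (h : M.IsAction G) (g : G) {v : M.V} (e : M.IncEdge v) : M.IncEdge (g • v) :=
  ⟨g • e.1, h.inc_smul g e.1 v e.2⟩

variable (G)

/-- The action of `G` preserves lengths, incidence and the boundary conditions: a function
satisfies the condition at `g • v` iff its pull-back by `g` satisfies the condition at `v`. -/
structure QuantumGraph.IsAction (Γ : QuantumGraph.{u}) [MulAction G Γ.graph.V]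
    [MulAction G Γ.graph.E] : Prop where
  graph : Γ.graph.IsAction G
  bc_smul : ∀ (g : G) (v : Γ.graph.V) (x y : Γ.graph.IncEdge (g • v) → ℂ),
    Γ.bc.Holds (g • v) x y ↔
      Γ.bc.Holds v (fun e => x (graph.smulInc g e)) (fun e => y (graph.smulInc g e))

end action

/-! ### The trivial component of a restricted representation and its complement -/

section rep

variable {G : Type*} [Group G] {W : Type*} [AddCommGroup W] [Module ℂ W]

/-- The restriction of `ρ` to the subgroup `H`. -/
def resRep (ρ : Representation ℂ G W) (H : Subgroup G) : Representation ℂ H W :=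
  MonoidHom.comp ρ H.subtype

/-- The trivial component of the restriction of `ρ` to `H`. -/
def trivialPart (ρ : Representation ℂ G W) (H : Subgroup G) : Submodule ℂ W :=
  (resRep ρ H).invariants

/-- The sum of the isotypic components of the restriction of `ρ` to `H` for the nontrivial
irreducible representations of `H`, i.e. the sum of all irreducible subrepresentations on which
`H` acts nontrivially. -/
def nontrivialPart (ρ : Representation ℂ G W) (H : Subgroup G) : Submodule ℂ W :=
  ⨆ (σ : Subrepresentation (resRep ρ H))
    (_ : σ.toRepresentation.IsIrreducible ∧ ¬ σ.toRepresentation.IsTrivial), σ.toSubmodule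

end rep

/-! ### The quotient graphs -/

section quotient

variable {G : Type*} [Group G] {W : Type*} [AddCommGroup W] [Module ℂ W]

/-- The choices made in the construction of a quotient graph `Γ/R`: representatives
`eRep i`, `vRep k` for the orbits of edges and vertices; a basis `B` of `R`; for each edge
representative `eRep i` a basis `edgeBasis i` of `R` whose first `dᵢ` vectors lie in (hence are a
basis of) the trivial component, of dimension `dᵢ`, of the restriction of `R` to the stabilizer of
`eRep i`, and whose other vectors lie in the sum of the nontrivial isotypic components; and, for
each edge at `vRep k`, an element of `G` that carries to it the representative of its orbit. -/
structure QuotientChoice (M : MetricGraph.{u}) [MulAction G M.V] [MulAction G M.E]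
    (ρ : Representation ℂ G W) where
  eRep : MulAction.orbitRel.Quotient G M.E → M.E
  mk_eRep : ∀ i, (Quotient.mk'' (eRep i) : MulAction.orbitRel.Quotient G M.E) = i
  vRep : MulAction.orbitRel.Quotient G M.V → M.V
  mk_vRep : ∀ k, (Quotient.mk'' (vRep k) : MulAction.orbitRel.Quotient G M.V) = k
  B : Module.Basis (Fin (Module.finrank ℂ W)) ℂ W
  edgeBasis : MulAction.orbitRel.Quotient G M.E → Module.Basis (Fin (Module.finrank ℂ W)) ℂ W
  edgeBasis_mem_trivial : ∀ i (j : Fin (Module.finrank ℂ W)),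
    (j : ℕ) < Module.finrank ℂ (trivialPart ρ (MulAction.stabilizer G (eRep i))) →
      edgeBasis i j ∈ trivialPart ρ (MulAction.stabilizer G (eRep i))
  edgeBasis_mem_nontrivial : ∀ i (j : Fin (Module.finrank ℂ W)),
    Module.finrank ℂ (trivialPart ρ (MulAction.stabilizer G (eRep i))) ≤ (j : ℕ) →
      edgeBasis i j ∈ nontrivialPart ρ (MulAction.stabilizer G (eRep i))
  elt : ∀ k, M.IncEdge (vRep k) → G
  elt_smul : ∀ k (e : M.IncEdge (vRep k)),
    elt k e • eRep (Quotient.mk'' e.1) = e.1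

namespace QuotientChoice

variable {M : MetricGraph.{u}} [MulAction G M.V] [MulAction G M.E] {ρ : Representation ℂ G W}
  (c : QuotientChoice M ρ)

/-- The number `dᵢ` of copies of the edge `eRep i` in the quotient. -/
def dim (i : MulAction.orbitRel.Quotient G M.E) : ℕ :=
  Module.finrank ℂ (trivialPart ρ (MulAction.stabilizer G (c.eRep i)))

/-- The metric graph underlying the quotient: its vertices are the orbits of vertices, its edges
are the pairs `(i, j)` with `j` among the first `dᵢ` indices; the edge `(i, j)` is a copy of
`eRep i`, and connects the orbits of the ends of `eRep i`. -/
def quotientMetric (hG : M.NoNeighborInOrbit G) : MetricGraph.{u} where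
  V := MulAction.orbitRel.Quotient G M.V
  E := {p : MulAction.orbitRel.Quotient G M.E × Fin (Module.finrank ℂ W) // (p.2 : ℕ) < c.dim p.1}
  fintypeV := by
    classical exact @Fintype.ofFinite _ (Quotient.finite (MulAction.orbitRel G M.V))
  fintypeE := by
    classical
    haveI : Finite (MulAction.orbitRel.Quotient G M.E) :=
      Quotient.finite (MulAction.orbitRel G M.E)
    exact Fintype.ofFinite _
  src e := Quotient.mk'' (M.src (c.eRep e.1.1))
  tgt e := Quotient.mk'' (M.tgt (c.eRep e.1.1))
  src_ne_tgt e h := by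
    have h1 := Quotient.exact h.symm
    obtain ⟨g, hg⟩ := (MulAction.orbitRel_apply.mp h1)
    exact hG g _ hg
  len e := M.len (c.eRep e.1.1)
  len_pos e := M.len_pos _

open Classical in
/-- The block diagonal matrix `diag([ρ(g₁⁻¹)], …, [ρ(gₙ⁻¹)])ᵀ` at the vertex `vRep k`. The block of
the edge `l = g_l • eRep i` is the transpose of the matrix of `ρ(g_l⁻¹)` from the basis `B` to the
basis `edgeBasis i`. -/
def repMatrix (k : MulAction.orbitRel.Quotient G M.V) :
    Matrix (M.IncEdge (c.vRep k) × Fin (Module.finrank ℂ W))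
      (M.IncEdge (c.vRep k) × Fin (Module.finrank ℂ W)) ℂ :=
  Matrix.of fun p q =>
    if p.1 = q.1 then
      (LinearMap.toMatrix c.B (c.edgeBasis (Quotient.mk'' p.1.1)) (ρ (c.elt k p.1)⁻¹)).transpose
        p.2 q.2
    else 0

open Classical in
/-- The matrix `Θ`: the columns of `Θ' ⊗ I_d` which belong to the edges of the quotient at `k`,
where `Θ'` has entry `1` at `(l, i)` if the edge `l` belongs to the orbit `i`, and else `0`. -/
def theta (hG : M.NoNeighborInOrbit G) (k : MulAction.orbitRel.Quotient G M.V) :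
    Matrix (M.IncEdge (c.vRep k) × Fin (Module.finrank ℂ W))
      ((c.quotientMetric hG).IncEdge k) ℂ :=
  Matrix.submatrix
    ((Matrix.of fun (l : M.IncEdge (c.vRep k)) (i : MulAction.orbitRel.Quotient G M.E) =>
        if (Quotient.mk'' l.1 : MulAction.orbitRel.Quotient G M.E) = i then (1 : ℂ) else 0) ⊗ₖ
      (1 : Matrix (Fin (Module.finrank ℂ W)) (Fin (Module.finrank ℂ W)) ℂ))
    id (fun e => e.1.1)

/-- The boundary conditions of the quotient:
`A_k = (A_{vRep k} ⊗ I_d) · diag(…)ᵀ · Θ` and `B_k = (B_{vRep k} ⊗ I_d) · diag(…)ᵀ · Θ`. -/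
def quotientBC (bc : BoundaryConditions M) (hG : M.NoNeighborInOrbit G) :
    BoundaryConditions (c.quotientMetric hG) where
  Row k := bc.Row (c.vRep k) × Fin (Module.finrank ℂ W)
  fintypeRow k := inferInstanceAs (Fintype (bc.Row (c.vRep k) × Fin (Module.finrank ℂ W)))
  A k := (bc.A (c.vRep k) ⊗ₖ (1 : Matrix (Fin (Module.finrank ℂ W)) (Fin (Module.finrank ℂ W)) ℂ))
    * c.repMatrix k * c.theta hG k
  B k := (bc.B (c.vRep k) ⊗ₖ (1 : Matrix (Fin (Module.finrank ℂ W)) (Fin (Module.finrank ℂ W)) ℂ))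
    * c.repMatrix k * c.theta hG k

end QuotientChoice

/-- `Q` is a quotient graph `Γ/R`: it is obtained by the construction for some choices, where the
matrices of the boundary conditions may be replaced (for instance by eliminating redundant rows)
by any matrices describing the same boundary conditions. -/
def IsQuotientGraph (Γ : QuantumGraph.{u}) [MulAction G Γ.graph.V] [MulAction G Γ.graph.E]
    (hG : Γ.graph.NoNeighborInOrbit G) (ρ : Representation ℂ G W) (Q : QuantumGraph.{u}) : Prop :=
  ∃ (c : QuotientChoice Γ.graph ρ) (bc : BoundaryConditions (c.quotientMetric hG)),
    bc.Same (c.quotientBC Γ.bc hG) ∧ Q = ⟨c.quotientMetric hG, bc⟩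

end quotient

end

/-!
A function on a quotient graph `Γ/R` is an equivariant map from `W` to functions on `Γ`. For a
system of choices `c`, let `b⁎ j`, `j < dᵢ`, be the coordinates along the trivial part of the basis
at the edge `eRep i`. A function `f` on the quotient determines on each edge `e = g • eRep i` the
family of functions `w ↦ ∑ j, b⁎ j (ρ g⁻¹ w) • f (i, j)`. By the averaging argument of
`coord_invariant`, the functionals `b⁎ j` are invariant under the stabilizer of `eRep i`, so the
family does not depend on `g` (`coord_inv_eq`). They also span the invariant functionals
(`sum_coord_mul_apply_vec`), so `f` is recovered from the family, whatever the choices.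

Comparing the families for two systems of choices `c`, `c'` gives the transplantation matrix: over
the orbit `i` its entries are `b⁎ j (ρ g⁻¹ b'ⱼ')` with `g • eRep i = eRep' i`. The matrices for
`(c, c')` and `(c', c)` are inverse to each other (`transMatrix_mul_transMatrix`).

The boundary conditions of the quotient at `k` say that the values and outgoing derivatives of the
family satisfy, at every `w`, the conditions of `Γ` at `vRep k` (`quotientBC_holds_iff`). The
families of a function and of its transplant agree (`lift_transMatrix`), up to the group element
that carries `vRep k` to `vRep' k`, and the conditions of `Γ` are `G`-invariant. Hence
transplantation preserves the conditions (`mapsTo_transplantMap`).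

The representatives `eRep i` and `eRep' i` may have their coordinates in opposite directions. As no
vertex is carried to a neighbor, the ends of an edge lie in different orbits, so the orbit of the
end at the coordinate `0` tells in which direction an edge points, and the coordinates are reversed
accordingly. The equation `-f'' = lam f` and the regularity of `f` are unaffected by a reversal.
-/

/-! ### Invariant functionals -/

section functionals

variable {G : Type*} [Group G] {W : Type*} [AddCommGroup W] [Module ℂ W]

/-- An `H`-invariant functional vanishes on the nontrivial isotypic components: on an irreducible
subrepresentation its kernel is a subrepresentation, and if that were zero, then invariance would
force `H` to act trivially. -/
lemma apply_eq_zero_of_mem_nontrivialPart {ρ : Representation ℂ G W} {H : Subgroup G}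
    {φ : W →ₗ[ℂ] ℂ} (hφ : ∀ h ∈ H, ∀ w, φ (ρ h w) = φ w) {w : W}
    (hw : w ∈ nontrivialPart ρ H) : φ w = 0 := by
  suffices h : nontrivialPart ρ H ≤ LinearMap.ker φ from h hw
  refine iSup₂_le fun σ hσ => ?_
  obtain ⟨hirr, hnt⟩ := hσ
  let K : Subrepresentation σ.toRepresentation :=
    { toSubmodule := LinearMap.ker (φ ∘ₗ σ.toSubmodule.subtype)
      apply_mem_toSubmodule := by
        intro g v hv
        have h1 : φ (ρ (g : G) (v : W)) = φ v := hφ g g.2 v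
        have h2 : φ (v : W) = 0 := hv
        change φ (ρ (g : G) (v : W)) = 0
        rw [h1, h2] }
  rcases hirr.eq_bot_or_eq_top K with hK | hK
  · refine absurd ⟨fun g => ?_⟩ hnt
    refine LinearMap.ext fun v => ?_
    have h1 : σ.toRepresentation g v - v ∈ K.toSubmodule := by
      change φ (ρ (g : G) (v : W) - v) = 0
      rw [map_sub, hφ g g.2, sub_self]
    rw [hK] at h1
    exact sub_eq_zero.mp h1
  · intro v hv
    have h1 : (⟨v, hv⟩ : σ.toSubmodule) ∈ K.toSubmodule := by
      rw [hK]
      trivial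
    exact h1

/-- If the vectors of a basis lie in the trivial component of `H` or in its nontrivial isotypic
components, then the coordinates of the former vectors are `H`-invariant: the coordinate agrees
with its average over `H` on the basis. -/
lemma coord_invariant [Finite G] {ρ : Representation ℂ G W} {H : Subgroup G} {ι : Type*}
    (b : Module.Basis ι ℂ W) (P : ι → Prop) (htriv : ∀ j, P j → b j ∈ trivialPart ρ H)
    (hnontriv : ∀ j, ¬ P j → b j ∈ nontrivialPart ρ H) {j : ι} (hj : P j) {h : G} (hh : h ∈ H)
    (w : W) : b.coord j (ρ h w) = b.coord j w := by
  classical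
  have : Fintype H := Fintype.ofFinite _
  let φ : W →ₗ[ℂ] ℂ := (Fintype.card H : ℂ)⁻¹ • ∑ g : H, b.coord j ∘ₗ ρ (g : G)
  have hcard : (Fintype.card H : ℂ) ≠ 0 := Nat.cast_ne_zero.mpr Fintype.card_ne_zero
  have happly : ∀ w, φ w = (Fintype.card H : ℂ)⁻¹ * ∑ g : H, b.coord j (ρ (g : G) w) := by
    intro w
    simp [φ]
  have hφ : ∀ g ∈ H, ∀ w, φ (ρ g w) = φ w := by
    intro g hg w
    rw [happly, happly]
    congr 1
    refine Fintype.sum_equiv (Equiv.mulRight (⟨g, hg⟩ : H)) _ _ fun x => ?_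
    simp [map_mul]
  have heq : φ = b.coord j := by
    refine b.ext fun k => ?_
    by_cases hk : P k
    · have h1 : ∀ g : H, ρ (g : G) (b k) = b k := htriv k hk
      rw [happly]
      simp only [h1, Finset.sum_const, Finset.card_univ, nsmul_eq_mul]
      rw [inv_mul_cancel_left₀ hcard]
    · rw [apply_eq_zero_of_mem_nontrivialPart hφ (hnontriv k hk)]
      have hjk : k ≠ j := fun h => hk (h ▸ hj)
      simp [hjk]
  rw [← heq]
  exact hφ h hh w

end functionals

/-! ### Coordinates along the edges of a quotient -/

namespace QuotientChoice

variable {G : Type*} [Group G] {W : Type*} [AddCommGroup W] [Module ℂ W]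
  {M : MetricGraph.{u}} [MulAction G M.V] [MulAction G M.E] {ρ : Representation ℂ G W}
  {hG : M.NoNeighborInOrbit G}

/-- The basis vector of `W` that belongs to the edge `q = (i, j)` of the quotient. -/
noncomputable def vec (c : QuotientChoice M ρ) (q : (c.quotientMetric hG).E) : W :=
  c.edgeBasis q.1.1 q.1.2

/-- The coordinate of a vector of `W` along `c.vec q`. -/
noncomputable def coord (c : QuotientChoice M ρ) (q : (c.quotientMetric hG).E) : W →ₗ[ℂ] ℂ :=
  (c.edgeBasis q.1.1).coord q.1.2

lemma coord_smul_of_mem_stabilizer [Finite G] (c : QuotientChoice M ρ)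
    (q : (c.quotientMetric hG).E) {h : G} (hh : h • c.eRep q.1.1 = c.eRep q.1.1) (w : W) :
    c.coord q (ρ h w) = c.coord q w :=
  coord_invariant (H := MulAction.stabilizer G (c.eRep q.1.1)) (c.edgeBasis q.1.1)
    (fun j => (j : ℕ) < c.dim q.1.1)
    (fun j hj => c.edgeBasis_mem_trivial _ j hj)
    (fun j hj => c.edgeBasis_mem_nontrivial _ j (not_lt.mp hj)) q.2 hh w

/-- The functional `c.coord q ∘ ρ g⁻¹` depends only on the edge `g • c.eRep i`, not on `g`. -/
lemma coord_inv_eq [Finite G] (c : QuotientChoice M ρ) (q : (c.quotientMetric hG).E) {g g' : G}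
    (h : g • c.eRep q.1.1 = g' • c.eRep q.1.1) (w : W) :
    c.coord q (ρ g⁻¹ w) = c.coord q (ρ g'⁻¹ w) := by
  have h1 : (g'⁻¹ * g) • c.eRep q.1.1 = c.eRep q.1.1 := by rw [mul_smul, h, inv_smul_smul]
  rw [← c.coord_smul_of_mem_stabilizer q h1 (ρ g⁻¹ w), ← Module.End.mul_apply, ← map_mul]
  simp

open Classical in
lemma coord_vec (c : QuotientChoice M ρ) (q q' : (c.quotientMetric hG).E)
    (h : q.1.1 = q'.1.1) : c.coord q (c.vec q') = if q = q' then 1 else 0 := by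
  obtain ⟨⟨i, j⟩, hj⟩ := q
  obtain ⟨⟨i', j'⟩, hj'⟩ := q'
  obtain rfl : i = i' := h
  simp only [coord, vec, Module.Basis.coord_apply, Module.Basis.repr_self, Finsupp.single_apply]
  refine if_congr ?_ rfl rfl
  exact ⟨fun h => Subtype.ext (Prod.ext rfl h.symm),
    fun h => (congrArg (fun q : (c.quotientMetric hG).E => q.1.2) h).symm⟩

open Classical in
/-- The coordinates along the copies of the edge `c.eRep i` span the functionals invariant under
its stabilizer. -/
lemma sum_coord_mul_apply_vec (c : QuotientChoice M ρ)
    (i : MulAction.orbitRel.Quotient G M.E) {φ : W →ₗ[ℂ] ℂ}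
    (hφ : ∀ h : G, h • c.eRep i = c.eRep i → ∀ w, φ (ρ h w) = φ w) (w : W) :
    ∑ q : (c.quotientMetric hG).E, (if q.1.1 = i then c.coord q w * φ (c.vec q) else 0)
      = φ w := by
  conv_rhs => rw [← (c.edgeBasis i).sum_repr w, map_sum]
  have h0 : ∀ j : Fin (Module.finrank ℂ W), ¬ (j : ℕ) < c.dim i → φ (c.edgeBasis i j) = 0 :=
    fun j hj => apply_eq_zero_of_mem_nontrivialPart (H := MulAction.stabilizer G (c.eRep i))
      (fun h hh => hφ h hh) (c.edgeBasis_mem_nontrivial i j (not_lt.mp hj))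
  rw [← Finset.sum_filter]
  symm
  have h1 : ∑ j : Fin (Module.finrank ℂ W), φ ((c.edgeBasis i).repr w j • c.edgeBasis i j)
      = ∑ j ∈ Finset.univ.filter (fun j : Fin (Module.finrank ℂ W) => (j : ℕ) < c.dim i),
        φ ((c.edgeBasis i).repr w j • c.edgeBasis i j) := by
    rw [Finset.sum_filter]
    refine Finset.sum_congr rfl fun j _ => ?_
    split_ifs with hj
    · rfl
    · rw [map_smul, h0 j hj, smul_zero]
  rw [h1]
  refine Finset.sum_bij (fun j hj => ⟨(i, j), (Finset.mem_filter.mp hj).2⟩) ?_ ?_ ?_ ?_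
  · intro j hj
    exact Finset.mem_filter.mpr ⟨Finset.mem_univ _, rfl⟩
  · intro j _ j' _ h
    exact (Prod.mk.inj (Subtype.mk.inj h)).2
  · rintro ⟨⟨i', j⟩, hj⟩ hq
    obtain rfl : i' = i := (Finset.mem_filter.mp hq).2
    exact ⟨j, Finset.mem_filter.mpr ⟨Finset.mem_univ _, hj⟩, rfl⟩
  · intro j _
    rw [map_smul, smul_eq_mul]
    rfl

end QuotientChoice

/-! ### Reversing the coordinate of an edge -/

section reversal

variable {l : ℝ}

/-- A function on `[0, l]`, read on `[0, l']` in the same coordinate if `b` holds and in the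
reversed coordinate otherwise; this is meant for `l = l'`. -/
noncomputable def edgePull (b : Prop) [Decidable b] (l' : ℝ) (f : Set.Icc (0 : ℝ) l → ℂ) :
    Set.Icc (0 : ℝ) l' → ℂ :=
  fun x => extZero f (if b then (x : ℝ) else l' - x)

lemma extZero_of_mem (f : Set.Icc (0 : ℝ) l → ℂ) {x : ℝ} (hx : x ∈ Set.Icc (0 : ℝ) l) :
    extZero f x = f ⟨x, hx⟩ := dif_pos hx

lemma edgePull_of_pos {b : Prop} [Decidable b] (hb : b) (f : Set.Icc (0 : ℝ) l → ℂ) :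
    edgePull b l f = f := by
  funext x
  simp only [edgePull, if_pos hb, extZero_of_mem f x.2]

lemma sub_mem_Icc {x : ℝ} (hx : x ∈ Set.Icc (0 : ℝ) l) : l - x ∈ Set.Icc (0 : ℝ) l :=
  ⟨sub_nonneg.mpr hx.2, sub_le_self l hx.1⟩

lemma extZero_edgePull_of_neg {b : Prop} [Decidable b] (hb : ¬ b) (f : Set.Icc (0 : ℝ) l → ℂ) :
    extZero (edgePull b l f) = fun x => extZero f (l - x) := by
  funext x
  by_cases hx : x ∈ Set.Icc (0 : ℝ) l
  · rw [extZero_of_mem _ hx]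
    simp only [edgePull, if_neg hb]
  · have hx' : l - x ∉ Set.Icc (0 : ℝ) l := fun h => hx (by simpa using sub_mem_Icc h)
    simp only [extZero, dif_neg hx, dif_neg hx']

lemma hasDerivWithinAt_extZero_comp_sub {f : Set.Icc (0 : ℝ) l → ℂ}
    (hf : DifferentiableOn ℝ (extZero f) (Set.Icc 0 l)) {x : ℝ} (hx : x ∈ Set.Icc (0 : ℝ) l) :
    HasDerivWithinAt (fun y => extZero f (l - y)) (-edgeDeriv f (l - x)) (Set.Icc 0 l) x := by
  have h1 : HasDerivWithinAt (extZero f) (edgeDeriv f (l - x)) (Set.Icc 0 l) (l - x) :=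
    (hf _ (sub_mem_Icc hx)).hasDerivWithinAt
  have h2 : HasDerivWithinAt (fun y : ℝ => l - y) (-1) (Set.Icc 0 l) x := by
    simpa using (hasDerivWithinAt_id x (Set.Icc 0 l)).const_sub l
  simpa [Function.comp_def] using h1.scomp x h2 fun y hy => sub_mem_Icc hy

lemma edgeDeriv_edgePull_of_neg {b : Prop} [Decidable b] (hb : ¬ b) (hl : 0 < l)
    {f : Set.Icc (0 : ℝ) l → ℂ} (hf : DifferentiableOn ℝ (extZero f) (Set.Icc 0 l))
    {x : ℝ} (hx : x ∈ Set.Icc (0 : ℝ) l) :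
    edgeDeriv (edgePull b l f) x = -edgeDeriv f (l - x) := by
  rw [edgeDeriv, extZero_edgePull_of_neg hb]
  exact (hasDerivWithinAt_extZero_comp_sub hf hx).derivWithin (uniqueDiffOn_Icc hl x hx)

lemma measurePreserving_const_sub_Icc (l : ℝ) :
    MeasurePreserving (fun x : ℝ => l - x) (volume.restrict (Set.Icc 0 l))
      (volume.restrict (Set.Icc 0 l)) := by
  have h := (volume.measurePreserving_sub_left l).restrict_preimage
    (measurableSet_Icc (a := (0 : ℝ)) (b := l))
  rwa [Set.preimage_const_sub_Icc, sub_self, sub_zero] at h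

lemma HasL2SecondDeriv.edgePull {b : Prop} [Decidable b] (hb : ¬ b) (hl : 0 < l)
    {f : Set.Icc (0 : ℝ) l → ℂ} {w : ℝ → ℂ} (hf : HasL2SecondDeriv f w) :
    HasL2SecondDeriv (edgePull b l f) (fun x => w (l - x)) where
  diff := by
    rw [extZero_edgePull_of_neg hb]
    exact fun x hx => (hasDerivWithinAt_extZero_comp_sub hf.diff hx).differentiableWithinAt
  memLp := hf.memLp.comp_measurePreserving (measurePreserving_const_sub_Icc l)
  deriv_eq x hx := by
    have hl' : l ∈ Set.Icc (0 : ℝ) l := ⟨hl.le, le_rfl⟩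
    rw [edgeDeriv_edgePull_of_neg hb hl hf.diff hx,
      edgeDeriv_edgePull_of_neg hb hl hf.diff ⟨le_rfl, hl.le⟩, sub_zero,
      hf.deriv_eq _ (sub_mem_Icc hx), hf.deriv_eq l hl',
      intervalIntegral.integral_comp_sub_left (fun y => w y) l, sub_zero,
      ← intervalIntegral.integral_add_adjacent_intervals
        (hf.intervalIntegrable (sub_mem_Icc hx))
        ((hf.intervalIntegrable (sub_mem_Icc hx)).symm.trans (hf.intervalIntegrable hl'))]
    ring

/-- A `W^{2,2}` solution of `-f'' = lam f` on a single edge. -/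
def IsEdgeEigen (lam : ℂ) (f : Set.Icc (0 : ℝ) l → ℂ) : Prop :=
  ∃ w : ℝ → ℂ, HasL2SecondDeriv f w ∧
    ∀ᵐ x ∂(volume.restrict (Set.Icc 0 l)), -w x = lam * extZero f x

lemma IsEdgeEigen.edgePull {lam : ℂ} (b : Prop) [Decidable b] (hl : 0 < l)
    {f : Set.Icc (0 : ℝ) l → ℂ} (hf : IsEdgeEigen lam f) : IsEdgeEigen lam (edgePull b l f) := by
  by_cases hb : b
  · rwa [edgePull_of_pos hb]
  · obtain ⟨w, hw, hw'⟩ := hf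
    refine ⟨fun x => w (l - x), hw.edgePull hb hl, ?_⟩
    rw [extZero_edgePull_of_neg hb]
    exact (measurePreserving_const_sub_Icc l).quasiMeasurePreserving.ae hw'

lemma IsEdgeEigen.zero {lam : ℂ} : IsEdgeEigen lam (0 : Set.Icc (0 : ℝ) l → ℂ) :=
  ⟨0, HasL2SecondDeriv.zero, by simp [extZero_zero]⟩

lemma IsEdgeEigen.add {lam : ℂ} (hl : 0 < l) {f g : Set.Icc (0 : ℝ) l → ℂ}
    (hf : IsEdgeEigen lam f) (hg : IsEdgeEigen lam g) : IsEdgeEigen lam (f + g) := by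
  obtain ⟨w, hw, hw'⟩ := hf
  obtain ⟨z, hz, hz'⟩ := hg
  refine ⟨w + z, hw.add hl.le hz, ?_⟩
  filter_upwards [hw', hz'] with x h1 h2
  simp only [Pi.add_apply, extZero_add, mul_add, ← h1, ← h2, neg_add]

lemma IsEdgeEigen.smul {lam : ℂ} (hl : 0 < l) (a : ℂ) {f : Set.Icc (0 : ℝ) l → ℂ}
    (hf : IsEdgeEigen lam f) : IsEdgeEigen lam (a • f) := by
  obtain ⟨w, hw, hw'⟩ := hf
  refine ⟨a • w, hw.smul hl.le a, ?_⟩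
  filter_upwards [hw'] with x h1
  simp only [Pi.smul_apply, extZero_smul, smul_eq_mul]
  rw [← mul_neg, h1]
  ring

lemma IsEdgeEigen.diff {lam : ℂ} {f : Set.Icc (0 : ℝ) l → ℂ} (hf : IsEdgeEigen lam f) :
    DifferentiableOn ℝ (extZero f) (Set.Icc 0 l) := hf.choose_spec.1.diff

lemma IsEdgeEigen.sum {lam : ℂ} (hl : 0 < l) {ι : Type*} (s : Finset ι)
    {F : ι → Set.Icc (0 : ℝ) l → ℂ} (hF : ∀ i ∈ s, IsEdgeEigen lam (F i)) :
    IsEdgeEigen lam (∑ i ∈ s, F i) :=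
  Finset.sum_induction F (IsEdgeEigen lam) (fun _ _ => IsEdgeEigen.add hl) IsEdgeEigen.zero hF

lemma extZero_sum {ι : Type*} (s : Finset ι) (F : ι → Set.Icc (0 : ℝ) l → ℂ) :
    extZero (∑ i ∈ s, F i) = ∑ i ∈ s, extZero (F i) := by
  classical
  induction s using Finset.induction_on with
  | empty => simp [extZero_zero]
  | insert i s hi ih => rw [Finset.sum_insert hi, Finset.sum_insert hi, extZero_add, ih]

lemma edgeDeriv_sum {ι : Type*} (s : Finset ι) {F : ι → Set.Icc (0 : ℝ) l → ℂ}
    (hF : ∀ i ∈ s, DifferentiableOn ℝ (extZero (F i)) (Set.Icc 0 l)) {x : ℝ}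
    (hx : x ∈ Set.Icc (0 : ℝ) l) : edgeDeriv (∑ i ∈ s, F i) x = ∑ i ∈ s, edgeDeriv (F i) x := by
  rw [edgeDeriv, extZero_sum, derivWithin_sum fun i hi => hF i hi x hx]
  rfl

end reversal

/-! ### Edge-wise linear maps and vertex data -/

namespace MetricGraph

variable {M₁ M₂ : MetricGraph.{u}} {T : Matrix M₂.E M₁.E ℂ} {r₁ : M₁.E → Bool} {r₂ : M₂.E → Bool}

lemma transplantMap_apply (f : M₁.Fun) (e₂ : M₂.E) :
    transplantMap M₁ M₂ T r₁ r₂ f e₂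
      = ∑ e₁, T e₂ e₁ • edgePull (r₁ e₁ = r₂ e₂) (M₂.len e₂) (f e₁) := by
  funext x
  rw [Finset.sum_apply]
  rfl

/-- Every summand of the restriction of the transplant to an edge is an eigenfunction there: a
nonzero coefficient forces the two lengths to agree. -/
lemma isEdgeEigen_smul_edgePull {lam : ℂ} {f : M₁.Fun} (hf : M₁.IsEdgewiseEigen lam f)
    (hlen : ∀ e₂ e₁, T e₂ e₁ ≠ 0 → M₁.len e₁ = M₂.len e₂) (e₂ : M₂.E) (e₁ : M₁.E)
    (b : Prop) [Decidable b] :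
    IsEdgeEigen lam (T e₂ e₁ • edgePull b (M₂.len e₂) (f e₁)) := by
  by_cases hT : T e₂ e₁ = 0
  · rw [hT, zero_smul]
    exact IsEdgeEigen.zero
  · rw [← hlen e₂ e₁ hT]
    exact (IsEdgeEigen.edgePull b (M₁.len_pos e₁) (hf e₁)).smul (M₁.len_pos e₁) _

lemma IsEdgewiseEigen.transplantMap {lam : ℂ} {f : M₁.Fun} (hf : M₁.IsEdgewiseEigen lam f)
    (hlen : ∀ e₂ e₁, T e₂ e₁ ≠ 0 → M₁.len e₁ = M₂.len e₂) :
    M₂.IsEdgewiseEigen lam (transplantMap M₁ M₂ T r₁ r₂ f) := by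
  intro e₂
  rw [transplantMap_apply]
  exact IsEdgeEigen.sum (M₂.len_pos e₂) _ fun e₁ _ => isEdgeEigen_smul_edgePull hf hlen e₂ e₁ _

/-- The value at the vertex `v` of the restriction of `f` to the edge `e`, the far end of `e` being
used if `v` is not the vertex at the coordinate `0`. -/
noncomputable def endValue (M : MetricGraph.{u}) (f : M.Fun) (v : M.V) (e : M.E) : ℂ := by
  classical exact if M.src e = v then extZero (f e) 0 else extZero (f e) (M.len e)

/-- The outgoing derivative at the vertex `v` of the restriction of `f` to the edge `e`, the far
end of `e` being used if `v` is not the vertex at the coordinate `0`. -/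
noncomputable def endDeriv (M : MetricGraph.{u}) (f : M.Fun) (v : M.V) (e : M.E) : ℂ := by
  classical exact if M.src e = v then edgeDeriv (f e) 0 else -edgeDeriv (f e) (M.len e)

open Classical in
/-- If the reversals of the coordinates match the ends of the edges at `v₁` and `v₂`, then the
matrix of the edge-wise map also acts on the values at the vertices. -/
lemma endValue_transplantMap {f : M₁.Fun} {v₁ : M₁.V} {v₂ : M₂.V} {e₂ : M₂.E}
    (hlen : ∀ e₁, T e₂ e₁ ≠ 0 → M₁.len e₁ = M₂.len e₂)
    (hends : ∀ e₁, T e₂ e₁ ≠ 0 → (r₁ e₁ = r₂ e₂ ↔ (M₁.src e₁ = v₁ ↔ M₂.src e₂ = v₂))) :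
    M₂.endValue (transplantMap M₁ M₂ T r₁ r₂ f) v₂ e₂
      = ∑ e₁, T e₂ e₁ * M₁.endValue f v₁ e₁ := by
  have key : ∀ {x : ℝ}, x ∈ Set.Icc (0 : ℝ) (M₂.len e₂) →
      extZero (transplantMap M₁ M₂ T r₁ r₂ f e₂) x
        = ∑ e₁, T e₂ e₁ * extZero (f e₁) (if r₁ e₁ = r₂ e₂ then x else M₂.len e₂ - x) :=
    fun {x} hx => extZero_of_mem _ hx
  unfold endValue
  split_ifs with h₂
  · rw [key (zero_mem_Icc e₂)]
    refine Finset.sum_congr rfl fun e₁ _ => ?_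
    by_cases hT : T e₂ e₁ = 0
    · rw [hT, zero_mul, zero_mul]
    · have h := hends e₁ hT
      simp only [h₂, iff_true] at h
      simp only [h, sub_zero, ← hlen e₁ hT]
      split_ifs <;> rfl
  · rw [key (len_mem_Icc e₂)]
    refine Finset.sum_congr rfl fun e₁ _ => ?_
    by_cases hT : T e₂ e₁ = 0
    · rw [hT, zero_mul, zero_mul]
    · have h := hends e₁ hT
      simp only [h₂, iff_false] at h
      simp only [h, sub_self, ← hlen e₁ hT]
      split_ifs <;> rfl

lemma edgeDeriv_edgePull {lam : ℂ} {f : M₁.Fun} (hf : M₁.IsEdgewiseEigen lam f) (e₁ : M₁.E)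
    (b : Prop) [Decidable b] {x : ℝ} (hx : x ∈ Set.Icc (0 : ℝ) (M₁.len e₁)) :
    edgeDeriv (edgePull b (M₁.len e₁) (f e₁)) x
      = if b then edgeDeriv (f e₁) x else -edgeDeriv (f e₁) (M₁.len e₁ - x) := by
  split_ifs with hb
  · rw [edgePull_of_pos hb]
  · exact edgeDeriv_edgePull_of_neg hb (M₁.len_pos e₁) (hf.diff e₁) hx

open Classical in
/-- If the reversals of the coordinates match the ends of the edges at `v₁` and `v₂`, then the
matrix of the edge-wise map also acts on the outgoing derivatives at the vertices. -/
lemma endDeriv_transplantMap {lam : ℂ} {f : M₁.Fun} (hf : M₁.IsEdgewiseEigen lam f)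
    {v₁ : M₁.V} {v₂ : M₂.V} {e₂ : M₂.E}
    (hlen : ∀ e₂ e₁, T e₂ e₁ ≠ 0 → M₁.len e₁ = M₂.len e₂)
    (hends : ∀ e₁, T e₂ e₁ ≠ 0 → (r₁ e₁ = r₂ e₂ ↔ (M₁.src e₁ = v₁ ↔ M₂.src e₂ = v₂))) :
    M₂.endDeriv (transplantMap M₁ M₂ T r₁ r₂ f) v₂ e₂
      = ∑ e₁, T e₂ e₁ * M₁.endDeriv f v₁ e₁ := by
  have key : ∀ {x : ℝ}, x ∈ Set.Icc (0 : ℝ) (M₂.len e₂) →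
      edgeDeriv (transplantMap M₁ M₂ T r₁ r₂ f e₂) x
        = ∑ e₁, T e₂ e₁ * (if r₁ e₁ = r₂ e₂ then edgeDeriv (f e₁) x
            else -edgeDeriv (f e₁) (M₂.len e₂ - x)) := by
    intro x hx
    rw [transplantMap_apply, edgeDeriv_sum _
      (fun e₁ _ => (isEdgeEigen_smul_edgePull hf hlen e₂ e₁ _).diff) hx]
    refine Finset.sum_congr rfl fun e₁ _ => ?_
    by_cases hT : T e₂ e₁ = 0
    · rw [hT, zero_mul, zero_smul, edgeDeriv_zero]
    · rw [← hlen e₂ e₁ hT] at hx ⊢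
      rw [edgeDeriv_smul _ (IsEdgeEigen.edgePull _ (M₁.len_pos e₁) (hf e₁)).diff hx,
        edgeDeriv_edgePull hf e₁ _ hx]
  unfold endDeriv
  split_ifs with h₂
  · rw [key (zero_mem_Icc e₂)]
    refine Finset.sum_congr rfl fun e₁ _ => ?_
    by_cases hT : T e₂ e₁ = 0
    · rw [hT, zero_mul, zero_mul]
    · have h := hends e₁ hT
      simp only [h₂, iff_true] at h
      simp only [h, sub_zero, ← hlen e₂ e₁ hT]
  · rw [key (len_mem_Icc e₂), ← Finset.sum_neg_distrib]
    refine Finset.sum_congr rfl fun e₁ _ => ?_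
    by_cases hT : T e₂ e₁ = 0
    · rw [hT, zero_mul, zero_mul, neg_zero]
    · have h := hends e₁ hT
      simp only [h₂, iff_false] at h
      simp only [h, sub_self, ← hlen e₂ e₁ hT]
      split_ifs <;> simp

end MetricGraph

open Classical in
/-- Edge-wise linear maps in opposite directions with the same coordinate reversals compose as
their matrices do; only the case of inverse matrices is stated. -/
lemma transplantMap_transplantMap {M₁ M₂ : MetricGraph.{u}} {T : Matrix M₂.E M₁.E ℂ}
    {S : Matrix M₁.E M₂.E ℂ} {r₁ : M₁.E → Bool} {r₂ : M₂.E → Bool}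
    (hS : ∀ e₁ e₂, S e₁ e₂ ≠ 0 → M₂.len e₂ = M₁.len e₁) (hST : S * T = 1) (f : M₁.Fun) :
    transplantMap M₂ M₁ S r₂ r₁ (transplantMap M₁ M₂ T r₁ r₂ f) = f := by
  funext e x
  have h1 : ∀ e₂, S e e₂ * extZero (transplantMap M₁ M₂ T r₁ r₂ f e₂)
        (if r₂ e₂ = r₁ e then (x : ℝ) else M₁.len e - x)
      = ∑ e₁, S e e₂ * T e₂ e₁ *
        extZero (f e₁) (if r₁ e₁ = r₁ e then (x : ℝ) else M₁.len e - x) := by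
    intro e₂
    by_cases hz : S e e₂ = 0
    · simp [hz]
    have hl := hS e e₂ hz
    have hmem : (if r₂ e₂ = r₁ e then (x : ℝ) else M₁.len e - x)
        ∈ Set.Icc (0 : ℝ) (M₂.len e₂) := by
      rw [hl]
      split_ifs
      exacts [x.2, sub_mem_Icc x.2]
    rw [extZero_of_mem _ hmem]
    change S e e₂ * ∑ e₁, T e₂ e₁ * _ = _
    rw [Finset.mul_sum]
    refine Finset.sum_congr rfl fun e₁ _ => ?_
    rw [mul_assoc]
    congr 3
    simp only [hl]
    -- Of three Booleans two agree, and reversing a coordinate twice does nothing.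
    cases r₁ e₁ <;> cases r₁ e <;> cases r₂ e₂ <;> simp
  change ∑ e₂, S e e₂ * _ = _
  rw [Finset.sum_congr rfl fun e₂ _ => h1 e₂, Finset.sum_comm]
  simp only [← Finset.sum_mul, ← Matrix.mul_apply, hST, Matrix.one_apply, ite_mul, one_mul,
    zero_mul, Finset.sum_ite_eq, Finset.mem_univ, if_true]
  exact extZero_of_mem _ x.2

/-! ### Orbits of the ends of an edge -/

section ends

variable {G : Type*} [Group G] {M : MetricGraph.{u}} [MulAction G M.V] [MulAction G M.E]

lemma mk_smul_eq_mk {X : Type*} [MulAction G X] (g : G) (x : X) :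
    (Quotient.mk'' (g • x) : MulAction.orbitRel.Quotient G X) = Quotient.mk'' x :=
  Quotient.sound ⟨g, rfl⟩

/-- A group element carries the ends of `e` to the ends of `g • e`, in one of the two orders. -/
lemma MetricGraph.IsAction.orbit_ends (h : M.IsAction G) (g : G) (e : M.E) :
    ((Quotient.mk'' (M.src (g • e)) : MulAction.orbitRel.Quotient G M.V)
        = Quotient.mk'' (M.src e) ∧
      (Quotient.mk'' (M.tgt (g • e)) : MulAction.orbitRel.Quotient G M.V)
        = Quotient.mk'' (M.tgt e)) ∨
    ((Quotient.mk'' (M.src (g • e)) : MulAction.orbitRel.Quotient G M.V)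
        = Quotient.mk'' (M.tgt e) ∧
      (Quotient.mk'' (M.tgt (g • e)) : MulAction.orbitRel.Quotient G M.V)
        = Quotient.mk'' (M.src e)) := by
  have hne : g • M.src e ≠ g • M.tgt e := fun h => M.src_ne_tgt e (smul_left_cancel g h)
  rcases h.inc_smul g e _ (Or.inl rfl) with h1 | h1 <;>
    rcases h.inc_smul g e _ (Or.inr rfl) with h2 | h2
  · exact absurd (h1.symm.trans h2) hne
  · exact Or.inl ⟨by rw [h1, mk_smul_eq_mk], by rw [h2, mk_smul_eq_mk]⟩
  · exact Or.inr ⟨by rw [h2, mk_smul_eq_mk], by rw [h1, mk_smul_eq_mk]⟩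
  · exact absurd (h1.symm.trans h2) hne

lemma exists_smul_eq_of_mk_eq {X : Type*} [MulAction G X] {x y : X}
    (h : (Quotient.mk'' x : MulAction.orbitRel.Quotient G X) = Quotient.mk'' y) :
    ∃ g : G, g • x = y :=
  MulAction.orbitRel_apply.mp (Quotient.exact h.symm)

/-- The invariance of the boundary conditions, for a vertex `v'` that equals `g • v`. -/
lemma QuantumGraph.IsAction.holds_iff {Γ : QuantumGraph.{u}} [MulAction G Γ.graph.V]
    [MulAction G Γ.graph.E] (h : Γ.IsAction G) {g : G} {v v' : Γ.graph.V} (hv : g • v = v')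
    (x y : Γ.graph.IncEdge v' → ℂ) :
    Γ.bc.Holds v' x y ↔
      Γ.bc.Holds v (fun e => x ⟨g • e.1, hv ▸ h.graph.inc_smul g e.1 v e.2⟩)
        (fun e => y ⟨g • e.1, hv ▸ h.graph.inc_smul g e.1 v e.2⟩) := by
  subst hv
  exact h.bc_smul g v _ _

end ends

namespace QuotientChoice

variable {G : Type*} [Group G] {W : Type*} [AddCommGroup W] [Module ℂ W]
  {M : MetricGraph.{u}} [MulAction G M.V] [MulAction G M.E] {ρ : Representation ℂ G W}
  {hG : M.NoNeighborInOrbit G}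

/-- The orbit of the end of `c.eRep i` at the coordinate `0`, for an edge `q = (i, j)`. -/
noncomputable def srcOrbit (c : QuotientChoice M ρ) (q : (c.quotientMetric hG).E) :
    MulAction.orbitRel.Quotient G M.V := Quotient.mk'' (M.src (c.eRep q.1.1))

/-- The orbit of the other end of `c.eRep i`, for an edge `q = (i, j)`. -/
noncomputable def tgtOrbit (c : QuotientChoice M ρ) (q : (c.quotientMetric hG).E) :
    MulAction.orbitRel.Quotient G M.V := Quotient.mk'' (M.tgt (c.eRep q.1.1))

lemma srcOrbit_ne_tgtOrbit (c : QuotientChoice M ρ) (q : (c.quotientMetric hG).E) :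
    c.srcOrbit q ≠ c.tgtOrbit q := (c.quotientMetric hG).src_ne_tgt q

/-- The edges of the quotient at `k`, with `k` typed as an orbit rather than as a vertex of the
quotient. -/
noncomputable instance (c : QuotientChoice M ρ) (k : MulAction.orbitRel.Quotient G M.V) :
    Fintype ((c.quotientMetric hG).IncEdge k) :=
  MetricGraph.instFintypeIncEdge (c.quotientMetric hG) k

/-- Edges over the same orbit, in quotients for two systems of choices, have the same ends, in one
of the two orders. -/
lemma ends_eq (h : M.IsAction G) (c c' : QuotientChoice M ρ) {q : (c.quotientMetric hG).E}
    {q' : (c'.quotientMetric hG).E} (hq : q.1.1 = q'.1.1) :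
    (c.srcOrbit q = c'.srcOrbit q' ∧ c.tgtOrbit q = c'.tgtOrbit q') ∨
    (c.srcOrbit q = c'.tgtOrbit q' ∧ c.tgtOrbit q = c'.srcOrbit q') := by
  obtain ⟨g, hg⟩ : ∃ g : G, g • c'.eRep q'.1.1 = c.eRep q.1.1 :=
    exists_smul_eq_of_mk_eq (by rw [c.mk_eRep, c'.mk_eRep, hq])
  have := h.orbit_ends g (c'.eRep q'.1.1)
  rw [hg] at this
  exact this

lemma len_eq (h : M.IsAction G) (c c' : QuotientChoice M ρ) {q : (c.quotientMetric hG).E}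
    {q' : (c'.quotientMetric hG).E} (hq : q.1.1 = q'.1.1) :
    (c.quotientMetric hG).len q = (c'.quotientMetric hG).len q' := by
  obtain ⟨g, hg⟩ : ∃ g : G, g • c'.eRep q'.1.1 = c.eRep q.1.1 :=
    exists_smul_eq_of_mk_eq (by rw [c.mk_eRep, c'.mk_eRep, hq])
  have := h.len_smul g (c'.eRep q'.1.1)
  rw [hg] at this
  exact this

/-- The edges of the quotient over the orbit of an edge at `v` are incident to the orbit of `v`. -/
lemma incident_of_mk_eq (h : M.IsAction G) (c : QuotientChoice M ρ)
    {q : (c.quotientMetric hG).E} {e : M.E} {v : M.V} (hv : M.src e = v ∨ M.tgt e = v)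
    (hq : q.1.1 = Quotient.mk'' e) :
    c.srcOrbit q = Quotient.mk'' v ∨ c.tgtOrbit q = Quotient.mk'' v := by
  obtain ⟨g, hg⟩ : ∃ g : G, g • e = c.eRep q.1.1 :=
    exists_smul_eq_of_mk_eq (by rw [c.mk_eRep, hq])
  have := h.orbit_ends g e
  rw [hg] at this
  rcases this with ⟨h1, h2⟩ | ⟨h1, h2⟩ <;> rcases hv with rfl | rfl
  exacts [Or.inl h1, Or.inr h2, Or.inr h2, Or.inl h1]

/-! ### The boundary conditions of a quotient -/

open Classical in
/-- Data `x` on the edges of the quotient determine, for each edge `e = g • c.eRep i` of `M`, the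
functional `∑ j, x (i, j) • b⁎ j ∘ ρ g⁻¹` on `W`, where `b⁎` is the dual basis of
`c.edgeBasis i`. The relation between `g` and `e` is not part of the definition. -/
noncomputable def lift (c : QuotientChoice M ρ) (x : (c.quotientMetric hG).E → ℂ) (e : M.E)
    (g : G) : W →ₗ[ℂ] ℂ :=
  ∑ q, if q.1.1 = Quotient.mk'' e then x q • c.coord q ∘ₗ ρ g⁻¹ else 0

open Classical in
lemma lift_apply (c : QuotientChoice M ρ) (x : (c.quotientMetric hG).E → ℂ) (e : M.E) (g : G)
    (w : W) : c.lift x e g w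
      = ∑ q, if q.1.1 = Quotient.mk'' e then x q * c.coord q (ρ g⁻¹ w) else 0 := by
  rw [lift, LinearMap.sum_apply]
  refine Finset.sum_congr rfl fun q _ => ?_
  split_ifs <;> rfl

lemma repMatrix_mulVec_theta_mulVec (h : M.IsAction G) (c : QuotientChoice M ρ)
    (k : MulAction.orbitRel.Quotient G M.V) (x : (c.quotientMetric hG).E → ℂ)
    (p : M.IncEdge (c.vRep k) × Fin (Module.finrank ℂ W)) :
    (c.repMatrix k).mulVec ((c.theta hG k).mulVec fun q => x q.1) p
      = c.lift x p.1.1 (c.elt k p.1) (c.B p.2) := by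
  classical
  obtain ⟨l, r⟩ := p
  have htheta : ∀ j, (c.theta hG k).mulVec (fun q => x q.1) (l, j)
      = ∑ q : (c.quotientMetric hG).IncEdge k,
        if q.1.1.1 = Quotient.mk'' l.1 ∧ j = q.1.1.2 then x q.1 else 0 := by
    intro j
    refine Finset.sum_congr rfl fun q _ => ?_
    simp only [theta, Matrix.submatrix_apply, Matrix.kroneckerMap_apply, Matrix.of_apply, id,
      Matrix.one_apply, eq_comm (a := q.1.1.1)]
    split_ifs <;> simp_all
  have hrep : (c.repMatrix k).mulVec ((c.theta hG k).mulVec fun q => x q.1) (l, r)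
      = ∑ j, (c.edgeBasis (Quotient.mk'' l.1)).repr (ρ (c.elt k l)⁻¹ (c.B r)) j *
        (c.theta hG k).mulVec (fun q => x q.1) (l, j) := by
    rw [Matrix.mulVec, dotProduct, Fintype.sum_prod_type, Finset.sum_eq_single l]
    · refine Finset.sum_congr rfl fun j _ => ?_
      simp [repMatrix, LinearMap.toMatrix_apply]
    · intro l' _ hl'
      refine Finset.sum_eq_zero fun j _ => ?_
      simp [repMatrix, Ne.symm hl']
    · exact fun hl => absurd (Finset.mem_univ l) hl
  rw [hrep, lift_apply]
  simp only [htheta, Finset.mul_sum]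
  rw [Finset.sum_comm]
  have hq : ∀ q : (c.quotientMetric hG).IncEdge k,
      ∑ j, (c.edgeBasis (Quotient.mk'' l.1)).repr (ρ (c.elt k l)⁻¹ (c.B r)) j *
        (if q.1.1.1 = Quotient.mk'' l.1 ∧ j = q.1.1.2 then x q.1 else 0)
      = if q.1.1.1 = Quotient.mk'' l.1 then x q.1 * c.coord q.1 (ρ (c.elt k l)⁻¹ (c.B r))
        else 0 := by
    intro q
    split_ifs with hi
    · rw [Finset.sum_eq_single q.1.1.2]
      · rw [if_pos ⟨hi, rfl⟩, mul_comm, ← hi]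
        rfl
      · intro j _ hj
        rw [if_neg fun h => hj h.2, mul_zero]
      · exact fun hj => absurd (Finset.mem_univ _) hj
    · exact Finset.sum_eq_zero fun j _ => by rw [if_neg fun h => hi h.1, mul_zero]
  rw [Finset.sum_congr rfl fun q _ => hq q]
  -- Edges of the quotient that are not incident to `k` do not contribute.
  refine Finset.sum_bij_ne_zero (fun q _ _ => q.1) (fun _ _ _ => Finset.mem_univ _)
    (fun q _ _ q' _ _ hqq => Subtype.ext hqq) ?_ fun _ _ _ => rfl
  intro q _ hne
  have hi : q.1.1 = Quotient.mk'' l.1 := by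
    by_contra hi
    exact hne (if_neg hi)
  have hinc := c.incident_of_mk_eq h l.2 hi
  rw [c.mk_vRep] at hinc
  exact ⟨⟨q, hinc⟩, Finset.mem_univ _, hne, rfl⟩

lemma kronecker_one_mulVec {m n d : Type*} [Fintype n] [Fintype d] [DecidableEq d]
    (A : Matrix m n ℂ) (z : n × d → ℂ) (a : m) (r : d) :
    (A ⊗ₖ (1 : Matrix d d ℂ)).mulVec z (a, r) = ∑ l, A a l * z (l, r) := by
  rw [Matrix.mulVec, dotProduct, Fintype.sum_prod_type]
  refine Finset.sum_congr rfl fun l _ => ?_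
  simp [Matrix.kroneckerMap_apply, Matrix.one_apply]

lemma kronecker_mul_repMatrix_mul_theta_mulVec (h : M.IsAction G) (c : QuotientChoice M ρ)
    (k : MulAction.orbitRel.Quotient G M.V) {R : Type*} (A : Matrix R (M.IncEdge (c.vRep k)) ℂ)
    (x : (c.quotientMetric hG).E → ℂ) (a : R) (r : Fin (Module.finrank ℂ W)) :
    Matrix.mulVec ((A ⊗ₖ (1 : Matrix (Fin (Module.finrank ℂ W)) (Fin (Module.finrank ℂ W)) ℂ))
        * c.repMatrix k * c.theta hG k) (fun q => x q.1) (a, r)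
      = ∑ l, A a l * c.lift x l.1 (c.elt k l) (c.B r) := by
  rw [← Matrix.mulVec_mulVec, ← Matrix.mulVec_mulVec, kronecker_one_mulVec]
  exact Finset.sum_congr rfl fun l _ => by rw [c.repMatrix_mulVec_theta_mulVec h]

/-- The boundary conditions of the quotient at `k` say that the functionals lifted from the data
satisfy, at every vector of `W`, the boundary conditions of the original graph at `c.vRep k`. -/
lemma quotientBC_holds_iff (h : M.IsAction G) (c : QuotientChoice M ρ)
    (bc : BoundaryConditions M) (k : MulAction.orbitRel.Quotient G M.V)
    (x y : (c.quotientMetric hG).E → ℂ) :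
    (c.quotientBC bc hG).Holds k (fun q => x q.1) (fun q => y q.1) ↔
      ∀ w, bc.Holds (c.vRep k) (fun l => c.lift x l.1 (c.elt k l) w)
        (fun l => c.lift y l.1 (c.elt k l) w) := by
  let Φ : bc.Row (c.vRep k) → W →ₗ[ℂ] ℂ := fun a =>
    ∑ l, bc.A _ a l • c.lift x l.1 (c.elt k l) + ∑ l, bc.B _ a l • c.lift y l.1 (c.elt k l)
  have hΦ : ∀ a w, Φ a w = ∑ l, bc.A _ a l * c.lift x l.1 (c.elt k l) w
      + ∑ l, bc.B _ a l * c.lift y l.1 (c.elt k l) w := by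
    intro a w
    simp [Φ, LinearMap.sum_apply]
  have hL : (c.quotientBC bc hG).Holds k (fun q => x q.1) (fun q => y q.1) ↔
      ∀ a r, Φ a (c.B r) = 0 := by
    refine Iff.trans funext_iff
      (Iff.trans Prod.forall (forall_congr' fun a => forall_congr' fun r => ?_))
    rw [hΦ, ← c.kronecker_mul_repMatrix_mul_theta_mulVec h,
      ← c.kronecker_mul_repMatrix_mul_theta_mulVec h]
    rfl
  have hR : (∀ w, bc.Holds (c.vRep k) (fun l => c.lift x l.1 (c.elt k l) w)
      (fun l => c.lift y l.1 (c.elt k l) w)) ↔ ∀ a w, Φ a w = 0 := by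
    rw [forall_comm]
    refine forall_congr' fun w => ?_
    rw [BoundaryConditions.Holds, funext_iff]
    refine forall_congr' fun a => ?_
    rw [hΦ]
    rfl
  rw [hL, hR]
  refine forall_congr' fun a => ⟨fun hB w => ?_, fun hw r => hw _⟩
  have : Φ a = 0 := c.B.ext hB
  rw [this, LinearMap.zero_apply]

/-! ### The transplantation matrix -/

lemma exists_smul_eRep (c c' : QuotientChoice M ρ) (i : MulAction.orbitRel.Quotient G M.E) :
    ∃ g : G, g • c.eRep i = c'.eRep i :=
  exists_smul_eq_of_mk_eq (by rw [c.mk_eRep, c'.mk_eRep])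

open Classical in
/-- The transplantation matrix: if `g • c.eRep i = c'.eRep i`, then its block over the orbit `i` is
the matrix of `ρ g⁻¹` from the basis of the trivial component for `c'` to the one for `c`. -/
noncomputable def transMatrix (hG : M.NoNeighborInOrbit G) (c c' : QuotientChoice M ρ) :
    Matrix (c'.quotientMetric hG).E (c.quotientMetric hG).E ℂ := fun q' q =>
  if q.1.1 = q'.1.1 then
    c.coord q (ρ (c.exists_smul_eRep c' q.1.1).choose⁻¹ (c'.vec q'))
  else 0

lemma eq_of_transMatrix_ne_zero {c c' : QuotientChoice M ρ} {q' : (c'.quotientMetric hG).E}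
    {q : (c.quotientMetric hG).E} (h : transMatrix hG c c' q' q ≠ 0) : q.1.1 = q'.1.1 := by
  by_contra hne
  exact h (if_neg hne)

lemma transMatrix_apply [Finite G] (c c' : QuotientChoice M ρ) {q' : (c'.quotientMetric hG).E}
    {q : (c.quotientMetric hG).E} (hq : q.1.1 = q'.1.1) {g : G}
    (hg : g • c.eRep q.1.1 = c'.eRep q.1.1) :
    transMatrix hG c c' q' q = c.coord q (ρ g⁻¹ (c'.vec q')) := by
  rw [transMatrix, if_pos hq]
  exact c.coord_inv_eq q ((c.exists_smul_eRep c' q.1.1).choose_spec.trans hg.symm) _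

open Classical in
/-- The functional `c.coord q ∘ ρ g⁻¹` is invariant under the stabilizer of `c'.eRep i`, and the
transplantation matrix contains its coefficients with respect to the functionals `c'.coord q'`. -/
lemma sum_coord_mul_transMatrix [Finite G] (c c' : QuotientChoice M ρ)
    (i : MulAction.orbitRel.Quotient G M.E) {g : G} (hg : g • c.eRep i = c'.eRep i) (w : W)
    (q : (c.quotientMetric hG).E) :
    ∑ q' : (c'.quotientMetric hG).E,
      (if q'.1.1 = i then c'.coord q' w * transMatrix hG c c' q' q else 0)
      = if q.1.1 = i then c.coord q (ρ g⁻¹ w) else 0 := by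
  split_ifs with hq
  · subst hq
    rw [← LinearMap.comp_apply, ← c'.sum_coord_mul_apply_vec (hG := hG) q.1.1
      (φ := c.coord q ∘ₗ ρ g⁻¹) _ w]
    · refine Finset.sum_congr rfl fun q' _ => ?_
      split_ifs with hq'
      · rw [transMatrix_apply c c' hq'.symm hg]
        rfl
      · rfl
    · intro h hh w
      rw [LinearMap.comp_apply, LinearMap.comp_apply, ← Module.End.mul_apply, ← map_mul]
      have := c.coord_inv_eq q (g := h⁻¹ * g) (g' := g) (by
        rw [mul_smul, hg, inv_smul_eq_iff, hh]) w
      simpa [mul_inv_rev] using this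
  · refine Finset.sum_eq_zero fun q' _ => ?_
    split_ifs with hq'
    · rw [transMatrix, if_neg fun h => hq (h.trans hq'), mul_zero]
    · rfl

open Classical in
lemma transMatrix_mul_transMatrix [Finite G] (c c' : QuotientChoice M ρ) :
    transMatrix hG c' c * transMatrix hG c c' = 1 := by
  ext q p
  obtain ⟨g, hg⟩ := c.exists_smul_eRep c' q.1.1
  obtain ⟨g', hg'⟩ := c'.exists_smul_eRep c q.1.1
  rw [Matrix.mul_apply]
  have h1 : ∀ q' : (c'.quotientMetric hG).E,
      transMatrix hG c' c q q' * transMatrix hG c c' q' p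
        = if q'.1.1 = q.1.1 then
            c'.coord q' (ρ g'⁻¹ (c.vec q)) * transMatrix hG c c' q' p else 0 := by
    intro q'
    split_ifs with hq
    · rw [transMatrix_apply c' c hq (by rw [hq, hg'])]
    · rw [transMatrix, if_neg hq, zero_mul]
  rw [Finset.sum_congr rfl fun q' _ => h1 q', c.sum_coord_mul_transMatrix c' q.1.1 hg,
    Matrix.one_apply]
  split_ifs with hp hqp hqp
  · rw [← Module.End.mul_apply, ← map_mul, ← mul_inv_rev,
      c.coord_inv_eq p (g' := 1) (by rw [hp, mul_smul, hg, hg', one_smul]), inv_one, map_one,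
      Module.End.one_apply, c.coord_vec p q hp, if_pos hqp.symm]
  · rw [← Module.End.mul_apply, ← map_mul, ← mul_inv_rev,
      c.coord_inv_eq p (g' := 1) (by rw [hp, mul_smul, hg, hg', one_smul]), inv_one, map_one,
      Module.End.one_apply, c.coord_vec p q hp, if_neg (Ne.symm hqp)]
  · exact absurd (by rw [hqp]) hp
  · rfl

/-- Data on two quotients that are related by the transplantation matrix lift to the same
functionals on the edges of the original graph, up to the action of `h`. -/
lemma lift_transMatrix [Finite G] (c c' : QuotientChoice M ρ)
    {x : (c.quotientMetric hG).E → ℂ} {x' : (c'.quotientMetric hG).E → ℂ} {e : M.E} {g g' h : G}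
    (hg : g • c.eRep (Quotient.mk'' e) = e) (hg' : g' • c'.eRep (Quotient.mk'' e) = h • e)
    (hx : ∀ q' : (c'.quotientMetric hG).E, q'.1.1 = Quotient.mk'' e →
      x' q' = ∑ q, transMatrix hG c c' q' q * x q) (w : W) :
    c'.lift x' (h • e) g' w = c.lift x e g (ρ h⁻¹ w) := by
  classical
  obtain ⟨γ, hγ⟩ := c.exists_smul_eRep c' (Quotient.mk'' e)
  rw [lift_apply, lift_apply, mk_smul_eq_mk]
  have h1 : ∀ q' : (c'.quotientMetric hG).E,
      (if q'.1.1 = Quotient.mk'' e then x' q' * c'.coord q' (ρ g'⁻¹ w) else 0)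
        = ∑ q, x q * (if q'.1.1 = Quotient.mk'' e then
            c'.coord q' (ρ g'⁻¹ w) * transMatrix hG c c' q' q else 0) := by
    intro q'
    split_ifs with hq'
    · rw [hx q' hq', Finset.sum_mul]
      exact Finset.sum_congr rfl fun q _ => by ring
    · simp
  rw [Finset.sum_congr rfl fun q' _ => h1 q', Finset.sum_comm]
  refine Finset.sum_congr rfl fun q _ => ?_
  rw [← Finset.mul_sum, c.sum_coord_mul_transMatrix c' _ hγ]
  split_ifs with hq
  · have h2 := c.coord_inv_eq q (g := g' * γ) (g' := h * g)
      (by rw [hq, mul_smul, mul_smul, hγ, hg', hg]) w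
    simp only [mul_inv_rev, map_mul, Module.End.mul_apply] at h2
    rw [h2]
  · rw [mul_zero]

end QuotientChoice

/-! ### Transplanting eigenfunctions -/

section transplantation

variable {G : Type*} [Group G] [Finite G] {Γ : QuantumGraph.{u}} [MulAction G Γ.graph.V]
  [MulAction G Γ.graph.E] {hG : Γ.graph.NoNeighborInOrbit G} {W : Type*} [AddCommGroup W]
  [Module ℂ W] {ρ : Representation ℂ G W}

open QuotientChoice

/-- The transplant of an eigenfunction is an eigenfunction, provided that coordinates are reversed
exactly where the representatives of an orbit of edges have their coordinates in opposite
directions. -/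
lemma mapsTo_transplantMap (hΓ : Γ.IsAction G) (c c' : QuotientChoice Γ.graph ρ)
    {bc : BoundaryConditions (c.quotientMetric hG)}
    {bc' : BoundaryConditions (c'.quotientMetric hG)} (hbc : bc.Same (c.quotientBC Γ.bc hG))
    (hbc' : bc'.Same (c'.quotientBC Γ.bc hG)) {r : (c.quotientMetric hG).E → Bool}
    {r' : (c'.quotientMetric hG).E → Bool}
    (hr : ∀ q q', q.1.1 = q'.1.1 → (r q = r' q' ↔
      c.srcOrbit q = c'.srcOrbit q')) (lam : ℂ) :
    Set.MapsTo (transplantMap _ _ (transMatrix hG c c') r r')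
      (QuantumGraph.eigenspace ⟨c.quotientMetric hG, bc⟩ lam)
      (QuantumGraph.eigenspace ⟨c'.quotientMetric hG, bc'⟩ lam) := by
  classical
  rintro f ⟨hf, hf'⟩
  have hlen : ∀ q' q, transMatrix hG c c' q' q ≠ 0 →
      (c.quotientMetric hG).len q = (c'.quotientMetric hG).len q' :=
    fun q' q hT => len_eq hΓ.graph c c' (eq_of_transMatrix_ne_zero hT)
  have hends : ∀ (k : MulAction.orbitRel.Quotient G Γ.graph.V) q',
      (c'.srcOrbit q' = k ∨ c'.tgtOrbit q' = k) →
      ∀ q, transMatrix hG c c' q' q ≠ 0 → (r q = r' q' ↔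
        (c.srcOrbit q = k ↔ c'.srcOrbit q' = k)) := by
    intro k q' hk q hT
    have hq := eq_of_transMatrix_ne_zero hT
    have hne := c'.srcOrbit_ne_tgtOrbit q'
    rw [hr q q' hq]
    rcases ends_eq hΓ.graph c c' hq with ⟨h1, -⟩ | ⟨h1, -⟩
    · rw [h1]
      exact iff_of_true rfl Iff.rfl
    · rw [h1]
      rcases hk with rfl | rfl
      · exact iff_of_false hne.symm fun h => hne.symm (h.mpr rfl)
      · exact iff_of_false hne.symm fun h => hne (h.mp rfl)
  refine ⟨hf.transplantMap hlen,
    fun (k : MulAction.orbitRel.Quotient G Γ.graph.V) => (hbc' k _ _).mpr ?_⟩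
  have hk := (hbc k _ _).mp (hf' k)
  -- On the edges at `k`, the end data are by definition the vertex data in the conditions.
  refine (c'.quotientBC_holds_iff hΓ.graph Γ.bc k
    ((c'.quotientMetric hG).endValue _ k) ((c'.quotientMetric hG).endDeriv _ k)).mpr fun w => ?_
  have hk' := (c.quotientBC_holds_iff hΓ.graph Γ.bc k
    ((c.quotientMetric hG).endValue f k) ((c.quotientMetric hG).endDeriv f k)).mp hk
  have hinc : ∀ (l : Γ.graph.IncEdge (c.vRep k)) (q' : (c'.quotientMetric hG).E),
      q'.1.1 = Quotient.mk'' l.1 → c'.srcOrbit q' = k ∨ c'.tgtOrbit q' = k := fun l q' hq' => by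
    have := c'.incident_of_mk_eq hΓ.graph l.2 hq'
    rwa [c.mk_vRep] at this
  obtain ⟨h, hh⟩ : ∃ h : G, h • c.vRep k = c'.vRep k :=
    exists_smul_eq_of_mk_eq (by rw [c.mk_vRep, c'.mk_vRep])
  rw [hΓ.holds_iff hh]
  convert hk' (ρ h⁻¹ w) using 1
  · funext l
    exact c.lift_transMatrix c' (c.elt_smul k l)
      (by rw [← mk_smul_eq_mk h l.1]; exact c'.elt_smul k _)
      (fun q' hq' => MetricGraph.endValue_transplantMap (hlen q')
        (hends k q' (hinc l q' hq'))) w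
  · funext l
    exact c.lift_transMatrix c' (c.elt_smul k l)
      (by rw [← mk_smul_eq_mk h l.1]; exact c'.elt_smul k _)
      (fun q' hq' => MetricGraph.endDeriv_transplantMap hf hlen
        (hends k q' (hinc l q' hq'))) w

end transplantation

theorem mainTheorem3 {G : Type*} [Group G] [Finite G]
    (Γ : QuantumGraph.{u}) [MulAction G Γ.graph.V] [MulAction G Γ.graph.E]
    (hΓ : Γ.IsAction G) (hG : Γ.graph.NoNeighborInOrbit G)
    {W : Type*} [AddCommGroup W] [Module ℂ W] [FiniteDimensional ℂ W]
    (ρ : Representation ℂ G W)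
    (Γ₁ Γ₂ : QuantumGraph.{u})
    (h₁ : IsQuotientGraph Γ hG ρ Γ₁) (h₂ : IsQuotientGraph Γ hG ρ Γ₂) :
    Transplantable Γ₁ Γ₂ := by
  classical
  obtain ⟨c, bc, hbc, rfl⟩ := h₁
  obtain ⟨c', bc', hbc', rfl⟩ := h₂
  let r : (c.quotientMetric hG).E → Bool := fun _ => true
  -- A coordinate is reversed where the two representatives of an orbit point in opposite ways.
  let r' : (c'.quotientMetric hG).E → Bool := fun q' => decide
    ((Quotient.mk'' (Γ.graph.src (c.eRep q'.1.1)) : MulAction.orbitRel.Quotient G Γ.graph.V)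
      = Quotient.mk'' (Γ.graph.src (c'.eRep q'.1.1)))
  have hr : ∀ q q', q.1.1 = q'.1.1 → (r q = r' q' ↔
      c.srcOrbit q = c'.srcOrbit q') := by
    intro q q' hq
    simp only [r, r', ← hq, eq_comm (a := true), decide_eq_true_eq]
    simp only [QuotientChoice.srcOrbit, ← hq]
  have hr' : ∀ q' q, q'.1.1 = q.1.1 → (r' q' = r q ↔
      c'.srcOrbit q' = c.srcOrbit q) := fun q' q hq =>
    eq_comm.trans ((hr q q' hq.symm).trans eq_comm)
  have hlen : ∀ q' q, QuotientChoice.transMatrix hG c c' q' q ≠ 0 →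
      (c.quotientMetric hG).len q = (c'.quotientMetric hG).len q' := fun q' q hT =>
    QuotientChoice.len_eq hΓ.graph c c' (QuotientChoice.eq_of_transMatrix_ne_zero hT)
  have hlen' : ∀ q q', QuotientChoice.transMatrix hG c' c q q' ≠ 0 →
      (c'.quotientMetric hG).len q' = (c.quotientMetric hG).len q := fun q q' hT =>
    QuotientChoice.len_eq hΓ.graph c' c (QuotientChoice.eq_of_transMatrix_ne_zero hT)
  refine ⟨QuotientChoice.transMatrix hG c c', r, r', hlen, fun lam => ?_⟩
  refine Set.InvOn.bijOn (f' := transplantMap _ _ (QuotientChoice.transMatrix hG c' c) r' r)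
    ⟨fun f _ => ?_, fun f _ => ?_⟩ (mapsTo_transplantMap hΓ c c' hbc hbc' hr lam)
    (mapsTo_transplantMap hΓ c' c hbc' hbc hr' lam)
  · exact transplantMap_transplantMap hlen'
      (QuotientChoice.transMatrix_mul_transMatrix c c') f
  · exact transplantMap_transplantMap hlen
      (QuotientChoice.transMatrix_mul_transMatrix c' c) f
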